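/- Let $(\Omega,\nu)$ be an atomless standard Borel probability space and let $W:\Omega^2\to[0,1]$ be a graphon, i.e. a symmetric measurable function, with edge density $e=\int_{\Omega^2} W\,d\nu^{\otimes 2}$. A fractional vertex cover of $W$ is a function $\mathfrak c\in L^\infty(\Omega)$ with $0\le\mathfrak c\le 1$ almost everywhere such that the set $\{W\neq 0\}\setminus\{(x,y):\mathfrak c(x)+\mathfrak c(y)\ge 1\}$ is $\nu^{\otimes 2}$-null; let $\tau(W)$ be the infimum of $\int_\Omega\mathfrak c\,d\nu$ over all fractional vertex covers $\mathfrak c$ of $W$. Two graphons $W,U$ on $\Omega$ are isomorphic if there is a measure-preserving bijection $\varphi:\Omega\to\Omega$ (measurable with measurable inverse) such that $W(x,y)=U(\varphi(x),\varphi(y))$ for almost all $(x,y)$. For a measurable partition $\Omega=B_1\sqcup B_2$ with $\nu(B_1)=1-\sqrt{1-e}$, $\nu(B_2)=\sqrt{1-e}$, let $\Psi_e$ be the graphon equal to $0$ on $B_2\times B_2$ and $1$ elsewhere. For a measurable partition $\Omega=C_1\sqcup C_2$ with $\nu(C_1)=\sqrt e$, $\nu(C_2)=1-\sqrt e$, let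 $\Phi_e$ be the graphon equal to $1$ on $C_1\times C_1$ and $0$ elsewhere. Such graphons exist. **Theorem.** We have $$\tau(W)\ \ge\ \min\Big\{\sqrt{\tfrac e4},\ 1-\sqrt{1-e}\Big\},$$ where the minimum equals $1-\sqrt{1-e}$ if $e\le 0.64$ and equals $\sqrt{e/4}$ if $e\ge 0.64$. Furthermore, for any choice of the partitions defining $\Psi_e$ and $\Phi_e$, equality $\tau(W)=\min\{\sqrt{e/4},1-\sqrt{1-e}\}$ holds if and only if $e\le 0.64$ and $W$ is isomorphic to $\Psi_e$, or $e\ge 0.64$ and $W$ is isomorphic to $\Phi_e$. -/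

import Mathlib

open MeasureTheory

/-- A graphon on `Ω`: a symmetric measurable function `Ω² → [0,1]`. -/
structure Graphon (Ω : Type*) [MeasurableSpace Ω] where
  toFun : Ω → Ω → ℝ
  measurable' : Measurable (Function.uncurry toFun)
  symm' : ∀ x y, toFun x y = toFun y x
  mem_Icc' : ∀ x y, toFun x y ∈ Set.Icc (0 : ℝ) 1

namespace Graphon

variable {Ω : Type*} [MeasurableSpace Ω]

instance : CoeFun (Graphon Ω) (fun _ => Ω → Ω → ℝ) := ⟨Graphon.toFun⟩

/-- The edge density `∫ W dν²`. -/
noncomputable def edgeDensity (W : Graphon Ω) (ν : Measure Ω) : ℝ :=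
  ∫ p : Ω × Ω, W p.1 p.2 ∂(ν.prod ν)

/-- `c ∈ L^∞(Ω)` is a fractional vertex cover of `W` if `0 ≤ c ≤ 1` almost everywhere and
the set `supp W \ {(x, y) : c x + c y ≥ 1}` is null. -/
structure IsFractionalVertexCover (W : Graphon Ω) (ν : Measure Ω) (c : Ω → ℝ) : Prop where
  memLp : MemLp c ⊤ ν
  nonneg_le_one : ∀ᵐ x ∂ν, 0 ≤ c x ∧ c x ≤ 1
  cover : (ν.prod ν)
    ({p : Ω × Ω | W p.1 p.2 ≠ 0} \ {p : Ω × Ω | 1 ≤ c p.1 + c p.2}) = 0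

/-- The fractional cover ratio `τ(W)`: the infimum of the sizes `∫ c dν` of all fractional
vertex covers `c` of `W`. -/
noncomputable def fracCoverRatio (W : Graphon Ω) (ν : Measure Ω) : ℝ :=
  sInf {s : ℝ | ∃ c : Ω → ℝ, W.IsFractionalVertexCover ν c ∧ s = ∫ x, c x ∂ν}

/-- `W` and `U` are isomorphic: there is a measure-preserving bijection `φ` of `Ω` with
`W(x, y) = U(φ x, φ y)` for almost all `(x, y)`. -/
def Isomorphic (W U : Graphon Ω) (ν : Measure Ω) : Prop :=
  ∃ φ : Ω ≃ᵐ Ω, MeasurePreserving φ ν ν ∧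
    ∀ᵐ p : Ω × Ω ∂(ν.prod ν), W p.1 p.2 = U (φ p.1) (φ p.2)

/-- `U` is a representative of `Ψ_e`: for a partition `Ω = B ⊔ Bᶜ` with
`ν B = 1 - √(1 - e)`, `U` is `0` on `Bᶜ × Bᶜ` and `1` elsewhere. -/
def IsPsi (U : Graphon Ω) (ν : Measure Ω) (e : ℝ) : Prop :=
  ∃ B : Set Ω, MeasurableSet B ∧ ν.real B = 1 - √(1 - e) ∧
    (∀ x y, x ∉ B ∧ y ∉ B → U x y = 0) ∧ (∀ x y, ¬(x ∉ B ∧ y ∉ B) → U x y = 1)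

/-- `U` is a representative of `Φ_e`: for a partition `Ω = C ⊔ Cᶜ` with
`ν C = √e`, `U` is `1` on `C × C` and `0` elsewhere. -/
def IsPhi (U : Graphon Ω) (ν : Measure Ω) (e : ℝ) : Prop :=
  ∃ C : Set Ω, MeasurableSet C ∧ ν.real C = √e ∧
    (∀ x y, x ∈ C ∧ y ∈ C → U x y = 1) ∧ (∀ x y, ¬(x ∈ C ∧ y ∈ C) → U x y = 0)

/-- An atomless standard Borel probability space has measurable sets of every measure in
`[0,1]`. -/
theorem exists_measurableSet_measureReal_eq [StandardBorelSpace Ω] (ν : Measure Ω)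
    [IsProbabilityMeasure ν] [NullSingletonClass ν] {t : ℝ} (ht : t ∈ Set.Icc (0 : ℝ) 1) :
    ∃ B : Set Ω, MeasurableSet B ∧ ν.real B = t := by
  rcases eq_or_lt_of_le ht.1 with h0 | h0
  · exact ⟨∅, MeasurableSet.empty, by simp [← h0]⟩
  rcases eq_or_lt_of_le ht.2 with h1 | h1
  · exact ⟨Set.univ, MeasurableSet.univ, by simp [h1]⟩
  have hemb := measurableEmbedding_embeddingReal Ω
  set f := embeddingReal Ω with hf
  set μ := ν.map f with hμ
  have : IsProbabilityMeasure μ := Measure.isProbabilityMeasure_map hemb.measurable.aemeasurable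
  have hatom : ∀ x : ℝ, μ {x} = 0 := by
    intro x
    rw [hμ, hemb.map_apply]
    exact (Set.subsingleton_singleton.preimage hemb.injective).measure_zero ν
  have hcont : Continuous (ProbabilityTheory.cdf μ) := by
    rw [continuous_iff_continuousAt]
    intro x
    rw [continuousAt_iff_continuous_left'_right']
    constructor
    · refine (ProbabilityTheory.cdf μ).mono.continuousWithinAt_Iio_iff_leftLim_eq.2 ?_
      have h := (ProbabilityTheory.cdf μ).measure_singleton x
      rw [ProbabilityTheory.measure_cdf, hatom] at h
      have h2 := ENNReal.ofReal_eq_zero.1 h.symm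
      exact le_antisymm ((ProbabilityTheory.cdf μ).mono.leftLim_le le_rfl) (by linarith)
    · exact ((ProbabilityTheory.cdf μ).right_continuous x).mono Set.Ioi_subset_Ici_self
  obtain ⟨a, ha⟩ := ((ProbabilityTheory.tendsto_cdf_atBot μ).eventually (gt_mem_nhds h0)).exists
  obtain ⟨b, hb⟩ := ((ProbabilityTheory.tendsto_cdf_atTop μ).eventually (lt_mem_nhds h1)).exists
  obtain ⟨x, hx⟩ := mem_range_of_exists_le_of_exists_ge hcont ⟨a, ha.le⟩ ⟨b, hb.le⟩
  refine ⟨f ⁻¹' Set.Iic x, hemb.measurable measurableSet_Iic, ?_⟩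
  rw [← hx, ProbabilityTheory.cdf_eq_real, measureReal_def, measureReal_def, hμ, hemb.map_apply]

/-- `Ψ_e` exists. -/
theorem exists_isPsi [StandardBorelSpace Ω] (ν : Measure Ω)
    [IsProbabilityMeasure ν] [NullSingletonClass ν] {e : ℝ} (he : e ∈ Set.Icc (0 : ℝ) 1) :
    ∃ U : Graphon Ω, U.IsPsi ν e := by
  classical
  obtain ⟨B, hB, hν⟩ := exists_measurableSet_measureReal_eq ν (t := 1 - √(1 - e))
    ⟨by linarith [Real.sqrt_le_one.2 (by linarith [he.1] : 1 - e ≤ 1)],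
      by linarith [Real.sqrt_nonneg (1 - e)]⟩
  refine ⟨⟨fun x y => if x ∉ B ∧ y ∉ B then 0 else 1, ?_, ?_, ?_⟩, B, hB, hν, ?_, ?_⟩
  · refine Measurable.ite (p := fun p : Ω × Ω => p.1 ∉ B ∧ p.2 ∉ B) ?_ measurable_const
      measurable_const
    exact (measurable_fst hB.compl).inter (measurable_snd hB.compl)
  · intro x y; simp only [and_comm]
  · intro x y; split_ifs <;> simp
  · intro x y h; exact if_pos h
  · intro x y h; exact if_neg h

/-- `Φ_e` exists. -/
theorem exists_isPhi [StandardBorelSpace Ω] (ν : Measure Ω)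
    [IsProbabilityMeasure ν] [NullSingletonClass ν] {e : ℝ} (he : e ∈ Set.Icc (0 : ℝ) 1) :
    ∃ U : Graphon Ω, U.IsPhi ν e := by
  classical
  obtain ⟨C, hC, hν⟩ := exists_measurableSet_measureReal_eq ν (t := √e)
    ⟨Real.sqrt_nonneg e, Real.sqrt_le_one.2 he.2⟩
  refine ⟨⟨fun x y => if x ∈ C ∧ y ∈ C then 1 else 0, ?_, ?_, ?_⟩, C, hC, hν, ?_, ?_⟩
  · refine Measurable.ite (p := fun p : Ω × Ω => p.1 ∈ C ∧ p.2 ∈ C) ?_ measurable_const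
      measurable_const
    exact (measurable_fst hC).inter (measurable_snd hC)
  · intro x y; simp only [and_comm]
  · intro x y; split_ifs <;> simp
  · intro x y h; exact if_pos h
  · intro x y h; exact if_neg h

end Graphon

/-! Fractional vertex covers reduce to half-integral ones. Thresholding a cover `c` at `t` and at `1
- t` gives a set cover `(P, A)` of the bipartite double, and averaging over `t` shows that some `t`
has `ν P + ν A ≤ 2 ∫ c`. Conversely, half the sum of the indicators of `P` and `A` is a fractional
cover. Set covers form a lattice on which `ν P + ν A` is modular, so uncrossing makes a minimizing
sequence converge to an optimal pair, which may be taken with `A ⊆ P` (`exists_isSetCover_eq`).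

Write `a = ν A`, `p = ν P`, `t = τ(W)`, so that `a + p = 2t`. The support of `W` lies almost
everywhere in `coveredPairs P A`, hence `e ≤ p² + 2a(1 - p)`. For fixed `t` the right side is a
strictly convex quadratic in `a ∈ [0, t]`, with values `4t²` at `a = 0` and `1 - (1 - t)²` at `a =
t`. So `e` is at most the larger of the two, which is the lower bound (`mul_bound_add_le`).

Equality forces an endpoint and makes `W` the indicator of the covered pairs: a clique when `a = 0`,
the complement of a square when `a = p`. These are `Φ_e` and `Ψ_e` up to an automorphism carrying
one set to another of equal measure (`exists_measurePreserving_measurableEquiv`). -/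

section

open Filter Topology Set

/-! ### Set covers of the bipartite double and their lattice operations -/

namespace Graphon

variable {Ω : Type*} [MeasurableSpace Ω]

/-- A pair of measurable sets `(P, A)` such that almost every `(x, y)` in the support of `W` has
`x ∈ P` or `y ∈ A`: an integral vertex cover of the bipartite double of `W`. -/
structure IsSetCover (W : Graphon Ω) (ν : Measure Ω) (P A : Set Ω) : Prop where
  left : MeasurableSet P
  right : MeasurableSet A
  cover : ∀ᵐ p : Ω × Ω ∂(ν.prod ν), W p.1 p.2 ≠ 0 → p.1 ∈ P ∨ p.2 ∈ A

variable {W : Graphon Ω} {ν : Measure Ω}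

theorem ae_swap [SFinite ν] {p : Ω × Ω → Prop} (h : ∀ᵐ z ∂(ν.prod ν), p z) :
    ∀ᵐ z ∂(ν.prod ν), p z.swap :=
  (Measure.measurePreserving_swap (μ := ν) (ν := ν)).quasiMeasurePreserving.ae h

theorem ae_prod_of_ae {p : Ω → Prop} (h : ∀ᵐ x ∂ν, p x) :
    ∀ᵐ z : Ω × Ω ∂(ν.prod ν), p z.1 ∧ p z.2 := by
  filter_upwards [Measure.quasiMeasurePreserving_fst (μ := ν) (ν := ν) |>.ae h,
    Measure.quasiMeasurePreserving_snd (μ := ν) (ν := ν) |>.ae h] with z h1 h2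
  exact ⟨h1, h2⟩

namespace IsSetCover

theorem symm [SFinite ν] {P A : Set Ω} (h : W.IsSetCover ν P A) : W.IsSetCover ν A P := by
  refine ⟨h.right, h.left, ?_⟩
  filter_upwards [ae_swap h.cover] with z hz hW
  exact (hz (by rwa [Prod.fst_swap, Prod.snd_swap, W.symm'])).symm

theorem union_inter {P A P' A' : Set Ω} (h : W.IsSetCover ν P A) (h' : W.IsSetCover ν P' A') :
    W.IsSetCover ν (P ∪ P') (A ∩ A') := by
  refine ⟨h.left.union h'.left, h.right.inter h'.right, ?_⟩
  filter_upwards [h.cover, h'.cover] with z hz hz' hW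
  have h1 := hz hW
  have h2 := hz' hW
  simp only [mem_union, mem_inter_iff]
  tauto

theorem inter_union {P A P' A' : Set Ω} (h : W.IsSetCover ν P A) (h' : W.IsSetCover ν P' A') :
    W.IsSetCover ν (P ∩ P') (A ∪ A') := by
  refine ⟨h.left.inter h'.left, h.right.union h'.right, ?_⟩
  filter_upwards [h.cover, h'.cover] with z hz hz' hW
  have h1 := hz hW
  have h2 := hz' hW
  simp only [mem_union, mem_inter_iff]
  tauto

theorem iUnion_iInter {P A : ℕ → Set Ω} (h : ∀ n, W.IsSetCover ν (P n) (A n)) :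
    W.IsSetCover ν (⋃ n, P n) (⋂ n, A n) := by
  refine ⟨.iUnion fun n => (h n).left, .iInter fun n => (h n).right, ?_⟩
  filter_upwards [ae_all_iff.2 fun n => (h n).cover] with z hz hW
  by_contra! hcon
  obtain ⟨n, hn⟩ : ∃ n, z.2 ∉ A n := by simpa using hcon.2
  exact ((hz n hW).resolve_right hn |> fun hP => hcon.1 (mem_iUnion.2 ⟨n, hP⟩))

theorem iInter_iUnion [SFinite ν] {P A : ℕ → Set Ω} (h : ∀ n, W.IsSetCover ν (P n) (A n)) :
    W.IsSetCover ν (⋂ n, P n) (⋃ n, A n) :=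
  (iUnion_iInter fun n => (h n).symm).symm

end IsSetCover

/-! ### Half-integrality and attainment of the infimum -/

theorem bddBelow_cover_sizes :
    BddBelow {s : ℝ | ∃ c : Ω → ℝ, W.IsFractionalVertexCover ν c ∧ s = ∫ x, c x ∂ν} := by
  refine ⟨0, ?_⟩
  rintro s ⟨c, hc, rfl⟩
  exact integral_nonneg_of_ae (hc.nonneg_le_one.mono fun x hx => hx.1)

theorem fracCoverRatio_le {c : Ω → ℝ} (hc : W.IsFractionalVertexCover ν c) :
    W.fracCoverRatio ν ≤ ∫ x, c x ∂ν :=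
  csInf_le bddBelow_cover_sizes ⟨c, hc, rfl⟩

theorem cover_sizes_nonempty [IsProbabilityMeasure ν] :
    {s : ℝ | ∃ c : Ω → ℝ, W.IsFractionalVertexCover ν c ∧ s = ∫ x, c x ∂ν}.Nonempty := by
  refine ⟨_, fun _ => 1, ⟨memLp_const _, by simp, ?_⟩, rfl⟩
  norm_num

variable [IsProbabilityMeasure ν]

theorem IsSetCover.two_mul_fracCoverRatio_le {P A : Set Ω} (h : W.IsSetCover ν P A) :
    2 * W.fracCoverRatio ν ≤ ν.real P + ν.real A := by
  set f : Ω → ℝ := P.indicator fun _ => 1 / 2 with hf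
  set g : Ω → ℝ := A.indicator fun _ => 1 / 2 with hg
  have hP : MemLp f ⊤ ν := (memLp_const (1 / 2 : ℝ)).indicator h.left
  have hA : MemLp g ⊤ ν := (memLp_const (1 / 2 : ℝ)).indicator h.right
  have hc : W.IsFractionalVertexCover ν (f + g) := by
    refine ⟨hP.add hA, .of_forall fun x => ?_, ?_⟩
    · by_cases h1 : x ∈ P <;> by_cases h2 : x ∈ A <;> simp [hf, hg, h1, h2] <;> norm_num
    · rw [measure_eq_zero_iff_ae_notMem]
      filter_upwards [h.cover, h.symm.cover] with z h1 h2 hz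
      refine hz.2 ?_
      have h1 := h1 hz.1
      have h2 := h2 hz.1
      show 1 ≤ f z.1 + g z.1 + (f z.2 + g z.2)
      by_cases h3 : z.1 ∈ P <;> by_cases h4 : z.1 ∈ A <;> by_cases h5 : z.2 ∈ P <;>
        by_cases h6 : z.2 ∈ A <;> simp_all [hf, hg] <;> norm_num
  have := fracCoverRatio_le hc
  rw [integral_add' (hP.integrable le_top) (hA.integrable le_top), hf, hg,
    integral_indicator_const _ h.left, integral_indicator_const _ h.right] at this
  simp only [smul_eq_mul] at this
  linarith

/-- Layer-cake rounding: if `d x + d y ≥ 1`, then `d x ≥ t` or `d y > 1 - t`, for every `t`; a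
suitable `t` is found by averaging. -/
theorem exists_isSetCover_le {c : Ω → ℝ} (hc : W.IsFractionalVertexCover ν c) :
    ∃ P A, W.IsSetCover ν P A ∧ ν.real P + ν.real A ≤ 2 * ∫ x, c x ∂ν := by
  obtain ⟨d, hd, hcd⟩ := hc.memLp.1.aemeasurable
  have hd01 : ∀ᵐ x ∂ν, 0 ≤ d x ∧ d x ≤ 1 := by
    filter_upwards [hc.nonneg_le_one, hcd] with x hx hx'
    rwa [← hx']
  have hdc : ∀ᵐ p : Ω × Ω ∂(ν.prod ν), W p.1 p.2 ≠ 0 → 1 ≤ d p.1 + d p.2 := by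
    have h1 := Measure.quasiMeasurePreserving_fst (μ := ν) (ν := ν) |>.ae hcd
    have h2 := Measure.quasiMeasurePreserving_snd (μ := ν) (ν := ν) |>.ae hcd
    filter_upwards [h1, h2, measure_eq_zero_iff_ae_notMem.1 hc.cover] with p h1 h2 h3 hW
    rw [← h1, ← h2]
    by_contra h4
    exact h3 ⟨hW, h4⟩
  have hint : Integrable d ν := (hc.memLp.integrable le_top).congr hcd
  rw [integral_congr_ae hcd]
  have hle : ∫ x, d x ∂ν = ∫ t in Ioc (0 : ℝ) 1, ν.real {a | t ≤ d a} :=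
    hint.integral_eq_integral_Ioc_meas_le (hd01.mono fun x hx => hx.1) (hd01.mono fun x hx => hx.2)
  -- Reflection `t ↦ 1 - t`; strict and weak superlevel sets have the same measure for almost every
  -- level.
  have hlt : ∫ x, d x ∂ν = ∫ t in Ioc (0 : ℝ) 1, ν.real {a | 1 - t < d a} := by
    rw [hle, ← intervalIntegral.integral_of_le zero_le_one,
      ← intervalIntegral.integral_of_le zero_le_one]
    rw [intervalIntegral.integral_comp_sub_left (fun t => ν.real {a | t < d a}) 1]
    simp only [sub_self, sub_zero]
    refine intervalIntegral.integral_congr_ae ?_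
    filter_upwards [meas_le_ae_eq_meas_lt ν volume d] with t ht _
    exact congrArg ENNReal.toReal ht
  have hi1 : IntegrableOn (fun t => ν.real {a | t ≤ d a}) (Ioc (0 : ℝ) 1) := by
    refine (AntitoneOn.integrableOn_isCompact isCompact_Icc (s := Icc (0 : ℝ) 1) ?_).mono_set
      Ioc_subset_Icc_self
    intro s _ t _ hst
    exact measureReal_mono fun x hx => hst.trans hx
  have hi2 : IntegrableOn (fun t => ν.real {a | 1 - t < d a}) (Ioc (0 : ℝ) 1) := by
    refine (MonotoneOn.integrableOn_isCompact isCompact_Icc (s := Icc (0 : ℝ) 1) ?_).mono_set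
      Ioc_subset_Icc_self
    intro s _ t _ hst
    exact measureReal_mono fun x (hx : 1 - s < d x) => show 1 - t < d x by linarith
  obtain ⟨t, -, ht⟩ := exists_le_setAverage (μ := volume) (s := Ioc (0 : ℝ) 1) (by simp) (by simp)
    (hi1.add hi2)
  refine ⟨{a | t ≤ d a}, {a | 1 - t < d a}, ⟨measurableSet_le measurable_const hd,
    measurableSet_lt measurable_const hd, ?_⟩, ?_⟩
  · filter_upwards [hdc] with p hp hW
    have := hp hW
    rcases le_or_gt t (d p.1) with h | h
    · exact .inl h
    · exact .inr (show 1 - t < d p.2 by linarith)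
  · refine ht.trans_eq ?_
    rw [setAverage_eq]
    simp only [Pi.add_apply]
    rw [integral_add hi1 hi2, ← hle, ← hlt]
    simp
    ring

theorem exists_isSetCover_lt {r : ℝ} (hr : 2 * W.fracCoverRatio ν < r) :
    ∃ P A, W.IsSetCover ν P A ∧ ν.real P + ν.real A < r := by
  obtain ⟨s, ⟨c, hc, rfl⟩, hs⟩ := exists_lt_of_csInf_lt cover_sizes_nonempty
    (show W.fracCoverRatio ν < r / 2 by linarith)
  obtain ⟨P, A, h, hle⟩ := exists_isSetCover_le hc
  exact ⟨P, A, h, by linarith⟩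

theorem tendsto_measureReal_iUnion {s : ℕ → Set Ω} (hs : Monotone s) :
    Tendsto (fun n => ν.real (s n)) atTop (𝓝 (ν.real (⋃ n, s n))) :=
  (ENNReal.tendsto_toReal (measure_ne_top _ _)).comp (tendsto_measure_iUnion_atTop hs)

theorem tendsto_measureReal_iInter {s : ℕ → Set Ω} (hs : Antitone s)
    (hm : ∀ n, MeasurableSet (s n)) :
    Tendsto (fun n => ν.real (s n)) atTop (𝓝 (ν.real (⋂ n, s n))) :=
  (ENNReal.tendsto_toReal (measure_ne_top _ _)).comp
    (tendsto_measure_iInter_atTop (fun n => (hm n).nullMeasurableSet) hs ⟨0, measure_ne_top _ _⟩)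

/-- The infimum in the definition of the fractional cover ratio is attained by a half-integral
cover, equal to `1` on `A`, to `1 / 2` on `P \ A` and to `0` elsewhere. -/
theorem exists_isSetCover_eq :
    ∃ P A, W.IsSetCover ν P A ∧ A ⊆ P ∧ ν.real P + ν.real A = 2 * W.fracCoverRatio ν := by
  set τ := W.fracCoverRatio ν
  suffices ∃ P A, W.IsSetCover ν P A ∧ ν.real P + ν.real A ≤ 2 * τ by
    obtain ⟨P, A, h, hle⟩ := this
    -- Uncrossing the cover with its mirror image gives nested sets `A ∩ P ⊆ P ∪ A` of the same
    -- total measure.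
    have h' := h.union_inter h.symm
    refine ⟨_, _, h', inter_subset_left.trans subset_union_right, ?_⟩
    refine le_antisymm ?_ h'.two_mul_fracCoverRatio_le
    have := measureReal_union_add_inter (μ := ν) (s := P) h.right
    rw [inter_comm A P]
    linarith
  -- Summable excesses, so that uncrossing all covers from index `n` on costs at most `2 * (1 / 2) ^
  -- n`.
  choose P A hPA hlt using fun n : ℕ => exists_isSetCover_lt (W := W) (ν := ν)
    (r := 2 * τ + (1 / 2) ^ n) (by simp [τ])
  have hfin : ∀ n m, W.IsSetCover ν (⋃ k ≤ m, P (n + k)) (⋂ k ≤ m, A (n + k)) ∧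
      ν.real (⋃ k ≤ m, P (n + k)) + ν.real (⋂ k ≤ m, A (n + k)) ≤
        2 * τ + 2 * (1 / 2) ^ n - (1 / 2) ^ (n + m) := by
    intro n m
    induction m with
    | zero =>
      have := hlt n
      simp only [nonpos_iff_eq_zero, iUnion_iUnion_eq_left, iInter_iInter_eq_left, add_zero]
      exact ⟨hPA n, by linarith⟩
    | succ m ih =>
      rw [biUnion_le_succ, biInter_le_succ]
      refine ⟨ih.1.union_inter (hPA _), ?_⟩
      -- The opposite uncrossing is also a cover, so its size is at least `2τ`; by modularity the
      -- excesses of the two covers at most add up.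
      have h1 := (ih.1.inter_union (hPA (n + (m + 1)))).two_mul_fracCoverRatio_le
      have h2 := measureReal_union_add_inter (μ := ν) (s := ⋃ k ≤ m, P (n + k))
        (hPA (n + (m + 1))).left (measure_ne_top _ _) (measure_ne_top _ _)
      have h3 := measureReal_union_add_inter (μ := ν) (s := ⋂ k ≤ m, A (n + k))
        (hPA (n + (m + 1))).right (measure_ne_top _ _) (measure_ne_top _ _)
      have h4 := hlt (n + (m + 1))
      have h5 : (1 / 2 : ℝ) ^ (n + m) = 2 * (1 / 2) ^ (n + (m + 1)) := by ring
      linarith [ih.2]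
  have hcov : ∀ n, W.IsSetCover ν (⋃ k, P (n + k)) (⋂ k, A (n + k)) := fun n =>
    IsSetCover.iUnion_iInter fun k => hPA (n + k)
  have hle : ∀ n, ν.real (⋃ k, P (n + k)) + ν.real (⋂ k, A (n + k)) ≤
      2 * τ + 2 * (1 / 2) ^ n := by
    intro n
    have h1 := tendsto_measureReal_iUnion (ν := ν) (s := fun m => ⋃ k ≤ m, P (n + k))
      fun i j hij => biUnion_mono (fun k hk => le_trans hk hij) fun _ _ => subset_rfl
    have h2 := tendsto_measureReal_iInter (ν := ν) (s := fun m => ⋂ k ≤ m, A (n + k))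
      (fun i j hij => biInter_mono (fun k hk => le_trans hk hij) fun _ _ => subset_rfl)
      fun m => (hfin n m).1.right
    have e1 : ⋃ m, ⋃ k ≤ m, P (n + k) = ⋃ k, P (n + k) := by
      ext x; simp only [mem_iUnion]
      exact ⟨fun ⟨_, k, _, h⟩ => ⟨k, h⟩, fun ⟨k, h⟩ => ⟨k, k, le_rfl, h⟩⟩
    have e2 : ⋂ m, ⋂ k ≤ m, A (n + k) = ⋂ k, A (n + k) := by
      ext x; simp only [mem_iInter]
      exact ⟨fun h k => h k k le_rfl, fun h _ k _ => h k⟩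
    rw [e1] at h1
    rw [e2] at h2
    refine le_of_tendsto' (h1.add h2) fun m => (hfin n m).2.trans ?_
    have : (0 : ℝ) ≤ (1 / 2) ^ (n + m) := by positivity
    linarith
  -- Letting `n → ∞` removes the remaining excess: the optimal pair is a limsup of the `P n` and a
  -- liminf of the `A n`.
  refine ⟨_, _, IsSetCover.iInter_iUnion hcov, ?_⟩
  have h1 := tendsto_measureReal_iInter (ν := ν) (s := fun n => ⋃ k, P (n + k))
    (antitone_nat_of_succ_le fun n => iUnion_subset fun k => by
      rw [add_assoc]; exact subset_iUnion (fun k => P (n + k)) (1 + k)) fun n => (hcov n).left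
  have h2 := tendsto_measureReal_iUnion (ν := ν) (s := fun n => ⋂ k, A (n + k))
    (monotone_nat_of_le_succ fun n => subset_iInter fun k => by
      rw [add_assoc]; exact iInter_subset (fun k => A (n + k)) (1 + k))
  have h3 : Tendsto (fun n : ℕ => 2 * τ + 2 * (1 / 2 : ℝ) ^ n) atTop (𝓝 (2 * τ + 2 * 0)) :=
    ((tendsto_pow_atTop_nhds_zero_of_lt_one (by norm_num) (by norm_num)).const_mul 2).const_add _
  have := le_of_tendsto_of_tendsto' (h1.add h2) h3 hle
  linarith

end Graphon

/-! ### The extremal problem in the two measures -/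

/-- With `p = 2t - a` the density bound is a quadratic in `a` with leading coefficient 3, so it lies
exactly `3a(t - a)` below its chord over `[0, t]`. Everything is multiplied by `t` to avoid
division; the deficit is kept for the equality case. -/
theorem mul_bound_add_le {a p t e : ℝ} (ht : 2 * t = a + p) (ha : 0 ≤ a) (hap : a ≤ p)
    (h1 : 4 * t ^ 2 ≤ e) (h2 : 1 - (1 - t) ^ 2 ≤ e) :
    t * (p ^ 2 + 2 * a * (1 - p)) + 3 * a * (t - a) * t ≤ t * e := by
  obtain rfl : p = 2 * t - a := by linarith
  nlinarith [mul_le_mul_of_nonneg_left h1 (show 0 ≤ t - a by linarith),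
    mul_le_mul_of_nonneg_left h2 ha]

theorem min_sqrt_le_of_le {a p t e : ℝ} (ht : 2 * t = a + p) (ha : 0 ≤ a) (hap : a ≤ p)
    (he : e ≤ p ^ 2 + 2 * a * (1 - p)) : min √(e / 4) (1 - √(1 - e)) ≤ t := by
  by_contra! hlt
  have ht0 : 0 ≤ t := by linarith
  have h1 : t ^ 2 < e / 4 := (Real.lt_sqrt ht0).1 (hlt.trans_le (min_le_left _ _))
  have h2 : √(1 - e) < 1 - t := by linarith [min_le_right √(e / 4) (1 - √(1 - e))]
  have h3 : 1 - e < (1 - t) ^ 2 := (Real.sqrt_lt' ((Real.sqrt_nonneg _).trans_lt h2)).1 h2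
  rcases ht0.eq_or_lt with h0 | h0
  · nlinarith
  -- Both endpoint values are strictly below `e`, so the chord bound with their maximum in place of
  -- `e` contradicts `he`.
  · have hlt : max (4 * t ^ 2) (1 - (1 - t) ^ 2) < e := max_lt (by linarith) (by linarith)
    have h4 := mul_bound_add_le ht ha hap (le_max_left (4 * t ^ 2) (1 - (1 - t) ^ 2))
      (le_max_right _ _)
    have h5 : 0 ≤ 3 * a * (t - a) * t := mul_nonneg (mul_nonneg (by linarith) (by linarith)) ht0
    nlinarith [mul_lt_mul_of_pos_left hlt h0, mul_le_mul_of_nonneg_left he ht0]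

theorem eq_or_eq_zero_of_eq_min {a p t e : ℝ} (ht : 2 * t = a + p) (ha : 0 ≤ a) (hap : a ≤ p)
    (hp : p ≤ 1) (he : e ≤ p ^ 2 + 2 * a * (1 - p)) (he0 : 0 ≤ e) (he1 : e ≤ 1)
    (hmin : t = min √(e / 4) (1 - √(1 - e))) :
    e = p ^ 2 + 2 * a * (1 - p) ∧ (a = p ∧ a = 1 - √(1 - e) ∨ 0 < e ∧ a = 0 ∧ p = √e) := by
  have ht0 : 0 ≤ t := by linarith
  have hs := Real.sqrt_nonneg (1 - e)
  have hss := Real.sq_sqrt (show 0 ≤ 1 - e by linarith)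
  have h1 : 4 * t ^ 2 ≤ e := by
    have := (Real.le_sqrt ht0 (by linarith)).1 (hmin.trans_le (min_le_left _ _))
    linarith
  have h2 : 1 - (1 - t) ^ 2 ≤ e := by
    have := hmin.trans_le (min_le_right _ _)
    nlinarith
  -- At `t = 0` all quantities vanish and the first alternative is chosen: `Φ_e` is only admitted
  -- for `e ≥ 0.64`.
  rcases ht0.eq_or_lt with h0 | h0
  · obtain rfl : a = 0 := by linarith
    obtain rfl : p = 0 := by linarith
    obtain rfl : e = 0 := by linarith
    simp
  have h3 := mul_bound_add_le ht ha hap h1 h2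
  have h4 : 0 ≤ 3 * a * (t - a) * t := mul_nonneg (mul_nonneg (by linarith) (by linarith)) ht0
  have h5 := mul_le_mul_of_nonneg_left he ht0
  have h6 : e = p ^ 2 + 2 * a * (1 - p) := le_antisymm he (le_of_mul_le_mul_left (by linarith) h0)
  have h7 : 3 * a * (t - a) * t = 0 := by rw [← h6] at h3; linarith
  refine ⟨h6, ?_⟩
  -- Equality leaves no chord deficit, so `a` is an endpoint of `[0, t]`.
  have h8 : a = 0 ∨ t - a = 0 := by simpa [h0.ne'] using h7
  rcases h8 with rfl | h8
  · right
    obtain rfl : p = 2 * t := by linarith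
    refine ⟨by nlinarith, rfl, ?_⟩
    rw [h6, mul_zero, zero_mul, add_zero, Real.sqrt_sq (by linarith)]
  · left
    obtain rfl : a = t := by linarith
    obtain rfl : p = a := by linarith
    refine ⟨rfl, ?_⟩
    rw [show 1 - e = (1 - p) ^ 2 by rw [h6]; ring, Real.sqrt_sq (by linarith)]
    ring

/-- With `s = √(1 - e)` the squared inequality is `(1 - s)² ≤ (1 - s²) / 4`. Dividing by `1 - s`,
positive as `e > 0`, leaves `s ≥ 3/5`, that is `e ≤ 16/25`. -/
theorem sqrt_one_sub_le_iff {e : ℝ} (he0 : 0 < e) (he1 : e ≤ 1) :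
    1 - √(1 - e) ≤ √(e / 4) ↔ e ≤ 0.64 := by
  have hs := Real.sqrt_nonneg (1 - e)
  have hss := Real.sq_sqrt (show 0 ≤ 1 - e by linarith)
  generalize √(1 - e) = s at *
  obtain rfl : e = 1 - s ^ 2 := by linarith
  have hs1 : s < 1 := by nlinarith
  rw [Real.le_sqrt (by linarith) (by linarith)]
  constructor
  · intro h
    have : 0.6 ≤ s := by nlinarith
    nlinarith
  · intro h
    have : 0.6 ≤ s := by nlinarith
    nlinarith

theorem sqrt_le_one_sub_iff {e : ℝ} (he0 : 0 < e) (he1 : e ≤ 1) :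
    √(e / 4) ≤ 1 - √(1 - e) ↔ 0.64 ≤ e := by
  have hs := Real.sqrt_nonneg (1 - e)
  have hss := Real.sq_sqrt (show 0 ≤ 1 - e by linarith)
  generalize √(1 - e) = s at *
  obtain rfl : e = 1 - s ^ 2 := by linarith
  have hs1 : s < 1 := by nlinarith
  rw [Real.sqrt_le_left (by linarith)]
  constructor
  · intro h
    have : s ≤ 0.6 := by nlinarith
    nlinarith
  · intro h
    have : s ≤ 0.6 := by nlinarith
    nlinarith

theorem min_sqrt_eq_right {e : ℝ} (he0 : 0 ≤ e) (he1 : e ≤ 1) (h : e ≤ 0.64) :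
    min √(e / 4) (1 - √(1 - e)) = 1 - √(1 - e) := by
  rcases he0.eq_or_lt with rfl | h0
  · simp
  · exact min_eq_right ((sqrt_one_sub_le_iff h0 he1).2 h)

theorem min_sqrt_eq_left {e : ℝ} (he1 : e ≤ 1) (h : 0.64 ≤ e) :
    min √(e / 4) (1 - √(1 - e)) = √(e / 4) :=
  min_eq_left ((sqrt_le_one_sub_iff (by linarith) he1).2 h)

/-! ### Edge density against the covered pairs -/

namespace Graphon

variable {Ω : Type*} [MeasurableSpace Ω] {W : Graphon Ω} {ν : Measure Ω}

/-- The pairs that may belong to the support of a symmetric function with set cover `(P, A)`. -/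
def coveredPairs (P A : Set Ω) : Set (Ω × Ω) :=
  {z | (z.1 ∈ P ∨ z.2 ∈ A) ∧ (z.1 ∈ A ∨ z.2 ∈ P)}

theorem measurableSet_coveredPairs {P A : Set Ω} (hP : MeasurableSet P) (hA : MeasurableSet A) :
    MeasurableSet (coveredPairs P A) :=
  ((measurable_fst hP).union (measurable_snd hA)).inter
    ((measurable_fst hA).union (measurable_snd hP))

theorem measureReal_coveredPairs [IsProbabilityMeasure ν] {P A : Set Ω} (hP : MeasurableSet P)
    (hA : MeasurableSet A) (hAP : A ⊆ P) :
    (ν.prod ν).real (coveredPairs P A) = ν.real P ^ 2 + 2 * ν.real A * (1 - ν.real P) := by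
  have : coveredPairs P A = P ×ˢ P ∪ (A ×ˢ Pᶜ ∪ Pᶜ ×ˢ A) := by
    ext z
    have h1 := @hAP z.1
    have h2 := @hAP z.2
    simp only [coveredPairs, mem_ofPred_eq, mem_union, mem_prod, mem_compl_iff]
    tauto
  rw [this, measureReal_union _ ((hA.prod hP.compl).union (hP.compl.prod hA)),
    measureReal_union _ (hP.compl.prod hA), measureReal_prod_prod, measureReal_prod_prod,
    measureReal_prod_prod, probReal_compl_eq_one_sub hP]
  · ring
  · exact disjoint_left.2 fun z h1 h2 => h2.1 (hAP h1.1)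
  · refine disjoint_left.2 fun z h1 h2 => ?_
    rcases h2 with h2 | h2
    · exact h2.2 h1.2
    · exact h2.1 h1.1

theorem IsSetCover.ae_le_indicator [SFinite ν] {P A : Set Ω} (h : W.IsSetCover ν P A) :
    ∀ᵐ z ∂(ν.prod ν), W z.1 z.2 ≤ (coveredPairs P A).indicator 1 z := by
  filter_upwards [h.cover, h.symm.cover] with z h1 h2
  by_cases hz : W z.1 z.2 = 0
  · rw [hz]
    exact indicator_nonneg (fun _ _ => zero_le_one) z
  · rw [indicator_of_mem (show z ∈ coveredPairs P A from ⟨h1 hz, h2 hz⟩)]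
    exact (W.mem_Icc' _ _).2

variable [IsProbabilityMeasure ν]

theorem integrable (W : Graphon Ω) : Integrable (fun z : Ω × Ω => W z.1 z.2) (ν.prod ν) :=
  .of_bound W.measurable'.aestronglyMeasurable 1 <| .of_forall fun z => by
    rw [Real.norm_of_nonneg (W.mem_Icc' _ _).1]
    exact (W.mem_Icc' _ _).2

theorem edgeDensity_mem_Icc (W : Graphon Ω) : W.edgeDensity ν ∈ Icc (0 : ℝ) 1 := by
  refine ⟨integral_nonneg fun z => (W.mem_Icc' _ _).1, ?_⟩
  calc W.edgeDensity ν ≤ ∫ _ : Ω × Ω, (1 : ℝ) ∂(ν.prod ν) :=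
        integral_mono W.integrable (integrable_const _) fun z => (W.mem_Icc' _ _).2
    _ = 1 := by simp

theorem integral_indicator_coveredPairs {P A : Set Ω} (hP : MeasurableSet P)
    (hA : MeasurableSet A) (hAP : A ⊆ P) :
    ∫ z, (coveredPairs P A).indicator (1 : Ω × Ω → ℝ) z ∂(ν.prod ν) =
      ν.real P ^ 2 + 2 * ν.real A * (1 - ν.real P) := by
  rw [integral_indicator_one (measurableSet_coveredPairs hP hA), measureReal_coveredPairs hP hA hAP]

theorem IsSetCover.integrable_indicator {P A : Set Ω} (h : W.IsSetCover ν P A) :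
    Integrable ((coveredPairs P A).indicator (1 : Ω × Ω → ℝ)) (ν.prod ν) :=
  (integrable_const (1 : ℝ)).indicator (measurableSet_coveredPairs h.left h.right)

theorem IsSetCover.edgeDensity_le {P A : Set Ω} (h : W.IsSetCover ν P A) (hAP : A ⊆ P) :
    W.edgeDensity ν ≤ ν.real P ^ 2 + 2 * ν.real A * (1 - ν.real P) := by
  rw [← integral_indicator_coveredPairs h.left h.right hAP]
  exact integral_mono_ae W.integrable h.integrable_indicator h.ae_le_indicator

theorem IsSetCover.ae_eq_indicator {P A : Set Ω} (h : W.IsSetCover ν P A) (hAP : A ⊆ P)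
    (heq : W.edgeDensity ν = ν.real P ^ 2 + 2 * ν.real A * (1 - ν.real P)) :
    ∀ᵐ z ∂(ν.prod ν), W z.1 z.2 = (coveredPairs P A).indicator 1 z := by
  rw [← integral_indicator_coveredPairs h.left h.right hAP] at heq
  exact (integral_eq_iff_of_ae_le W.integrable h.integrable_indicator h.ae_le_indicator).1 heq

theorem min_le_fracCoverRatio (W : Graphon Ω) :
    min √(W.edgeDensity ν / 4) (1 - √(1 - W.edgeDensity ν)) ≤ W.fracCoverRatio ν := by
  obtain ⟨P, A, h, hAP, heq⟩ := exists_isSetCover_eq (W := W) (ν := ν)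
  exact min_sqrt_le_of_le (by linarith) measureReal_nonneg (measureReal_mono hAP)
    (h.edgeDensity_le hAP)

theorem Isomorphic.fracCoverRatio_le_of_isPsi {Ψ : Graphon Ω} {e : ℝ} (h : W.Isomorphic Ψ ν)
    (hΨ : Ψ.IsPsi ν e) : W.fracCoverRatio ν ≤ 1 - √(1 - e) := by
  obtain ⟨φ, hφ, hW⟩ := h
  obtain ⟨B, hB, hν, h0, -⟩ := hΨ
  have hcov : W.IsSetCover ν (φ ⁻¹' B) (φ ⁻¹' B) := by
    refine ⟨φ.measurable hB, φ.measurable hB, ?_⟩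
    filter_upwards [hW] with z hz hne
    by_contra! hcon
    exact hne (hz.trans (h0 _ _ hcon))
  have := hcov.two_mul_fracCoverRatio_le
  rw [hφ.measureReal_preimage hB.nullMeasurableSet, hν] at this
  linarith

theorem Isomorphic.fracCoverRatio_le_of_isPhi {Φ : Graphon Ω} {e : ℝ} (h : W.Isomorphic Φ ν)
    (hΦ : Φ.IsPhi ν e) : W.fracCoverRatio ν ≤ √(e / 4) := by
  obtain ⟨φ, hφ, hW⟩ := h
  obtain ⟨C, hC, hν, -, h0⟩ := hΦ
  -- The empty second set encodes the cover with constant weight `1 / 2` on the clique.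
  have hcov : W.IsSetCover ν (φ ⁻¹' C) ∅ := by
    refine ⟨φ.measurable hC, .empty, ?_⟩
    filter_upwards [hW] with z hz hne
    by_contra! hcon
    exact hne (hz.trans (h0 _ _ fun h => hcon.1 h.1))
  have := hcov.two_mul_fracCoverRatio_le
  rw [hφ.measureReal_preimage hC.nullMeasurableSet, hν, measureReal_empty] at this
  rw [show e / 4 = e / 2 ^ 2 by norm_num, Real.sqrt_div' _ (by norm_num), Real.sqrt_sq (by norm_num)]
  linarith

end Graphon

/-! ### Automorphisms of atomless standard Borel spaces -/

namespace MeasureTheory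

variable {Ω : Type*} [MeasurableSpace Ω] [StandardBorelSpace Ω] (ν : Measure Ω)
  [IsProbabilityMeasure ν] [NullSingletonClass ν]

/-- Identify `Ω` with the plane: of the uncountably many disjoint vertical lines, only countably
many can have positive measure. -/
theorem exists_not_countable_null :
    ∃ N : Set Ω, MeasurableSet N ∧ ¬ N.Countable ∧ ν N = 0 := by
  have hΩ : ¬ Countable Ω := fun h => by
    have := (Set.to_countable (univ : Set Ω)).measure_zero ν
    simp at this
  have hR : ¬ Countable (ℝ × ℝ) := fun h =>
    not_countable (α := ℝ) (Function.Injective.countable (f := fun x : ℝ => (x, x)) fun x y h =>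
      (Prod.ext_iff.1 h).1)
  let ψ : Ω ≃ᵐ ℝ × ℝ := PolishSpace.measurableEquivOfNotCountable hΩ hR
  let A : ℝ → Set Ω := fun x => ψ ⁻¹' (Prod.fst ⁻¹' {x})
  have hA : ∀ x, MeasurableSet (A x) := fun x =>
    ψ.measurable (measurable_fst (measurableSet_singleton x))
  have hpos := Measure.countable_meas_pos_of_disjoint_iUnion (μ := ν) hA fun x y hxy =>
    disjoint_left.2 fun z (hz : (ψ z).1 = x) (hz' : (ψ z).1 = y) => hxy (hz.symm.trans hz')
  obtain ⟨x, hx⟩ : ∃ x, ν (A x) = 0 := by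
    by_contra! hcon
    refine Set.not_countable_univ (α := ℝ) (hpos.mono fun x _ => ?_)
    exact pos_iff_ne_zero.2 (hcon x)
  refine ⟨A x, hA x, fun hc => Set.not_countable_univ (α := ℝ) ?_, hx⟩
  refine MapsTo.countable_of_injOn (f := fun y => ψ.symm (x, y)) (t := A x) (fun y _ => ?_) ?_ hc
  · simp [A]
  · intro y _ z _ h
    simpa using h

/-- The quantile function of an atomless probability measure on `ℝ` is a measurable right inverse of
the cumulative distribution function and transports the Lebesgue measure on `(0, 1)` to the given
measure. -/
theorem exists_quantile (μ : Measure ℝ) [IsProbabilityMeasure μ] [NullSingletonClass μ] :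
    ∃ Q : ℝ → ℝ, Measurable Q ∧ InjOn Q (Ioo 0 1) ∧
      (∀ u ∈ Ioo (0 : ℝ) 1, ∀ x, Q u ≤ x ↔ u ≤ μ.real (Iic x)) ∧
      (volume.restrict (Ioo (0 : ℝ) 1)).map Q = μ := by
  set F := ProbabilityTheory.cdf μ
  have hcont : Continuous F := by
    rw [continuous_iff_continuousAt]
    intro x
    rw [continuousAt_iff_continuous_left'_right']
    constructor
    · refine F.mono.continuousWithinAt_Iio_iff_leftLim_eq.2 ?_
      have h := F.measure_singleton x
      rw [ProbabilityTheory.measure_cdf, measure_singleton] at h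
      have h2 := ENNReal.ofReal_eq_zero.1 h.symm
      exact le_antisymm (F.mono.leftLim_le le_rfl) (by linarith)
    · exact (F.right_continuous x).mono Set.Ioi_subset_Ici_self
  have hsurj : ∀ u ∈ Ioo (0 : ℝ) 1, ∃ x, F x = u := by
    intro u hu
    obtain ⟨a, ha⟩ :=
      ((ProbabilityTheory.tendsto_cdf_atBot μ).eventually (gt_mem_nhds hu.1)).exists
    obtain ⟨b, hb⟩ :=
      ((ProbabilityTheory.tendsto_cdf_atTop μ).eventually (lt_mem_nhds hu.2)).exists
    exact mem_range_of_exists_le_of_exists_ge hcont ⟨a, ha.le⟩ ⟨b, hb.le⟩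
  have hbdd : ∀ u ∈ Ioo (0 : ℝ) 1, BddBelow {x | u ≤ F x} := by
    intro u hu
    obtain ⟨a, ha⟩ :=
      ((ProbabilityTheory.tendsto_cdf_atBot μ).eventually (gt_mem_nhds hu.1)).exists
    exact ⟨a, fun x (hx : u ≤ F x) => le_of_not_gt fun h => absurd (hx.trans (F.mono h.le)) ha.not_ge⟩
  have hne : ∀ u ∈ Ioo (0 : ℝ) 1, {x | u ≤ F x}.Nonempty := fun u hu =>
    (hsurj u hu).imp fun x hx => hx.ge
  have hclosed : ∀ u, IsClosed {x | u ≤ F x} := fun u => isClosed_le continuous_const hcont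
  -- The value 0 off `(0, 1)` is a convention; there the infimum need not be meaningful.
  let Q : ℝ → ℝ := (Ioo (0 : ℝ) 1).indicator fun u => sInf {x | u ≤ F x}
  have hQ : ∀ u ∈ Ioo (0 : ℝ) 1, Q u = sInf {x | u ≤ F x} := fun u hu => indicator_of_mem hu _
  have hgal : ∀ u ∈ Ioo (0 : ℝ) 1, ∀ x, Q u ≤ x ↔ u ≤ F x := by
    intro u hu x
    rw [hQ u hu]
    refine ⟨fun h => ?_, fun h => csInf_le (hbdd u hu) h⟩
    exact le_trans ((hclosed u).csInf_mem (hne u hu) (hbdd u hu)) (F.mono h)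
  -- Injectivity rests on the distribution function attaining every value in `(0, 1)`, which uses
  -- the absence of atoms.
  have hinj : InjOn Q (Ioo 0 1) := by
    intro u hu v hv huv
    have hle : ∀ u ∈ Ioo (0 : ℝ) 1, ∀ v ∈ Ioo (0 : ℝ) 1, Q u = Q v → u ≤ v := by
      intro u hu v hv huv
      obtain ⟨x, hx⟩ := hsurj v hv
      exact ((hgal u hu x).1 (huv.trans_le ((hgal v hv x).2 hx.ge))).trans_eq hx
    exact le_antisymm (hle u hu v hv huv) (hle v hv u hu huv.symm)
  have hpre : ∀ x, Q ⁻¹' Iic x ∩ Ioo 0 1 = Iic (F x) ∩ Ioo 0 1 := by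
    intro x
    ext u
    exact and_congr_left fun hu => hgal u hu x
  have hmeas : Measurable Q := by
    refine measurable_of_Iic fun x => ?_
    have : Q ⁻¹' Iic x = Iic (F x) ∩ Ioo 0 1 ∪ ((fun _ => (0 : ℝ)) ⁻¹' Iic x) ∩ (Ioo 0 1)ᶜ := by
      rw [← hpre, ← inter_union_compl (Q ⁻¹' Iic x) (Ioo 0 1)]
      congr 1
      · rw [inter_union_compl]
      · ext u
        refine and_congr_left fun hu => ?_
        simp only [mem_preimage]
        rw [show Q u = 0 from indicator_of_notMem hu _]
    rw [this]
    exact (measurableSet_Iic.inter measurableSet_Ioo).union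
      ((measurable_const measurableSet_Iic).inter measurableSet_Ioo.compl)
  have hprob : IsProbabilityMeasure (volume.restrict (Ioo (0 : ℝ) 1)) := ⟨by simp⟩
  refine ⟨Q, hmeas, hinj, fun u hu x => ?_, ?_⟩
  · rw [hgal u hu x, ← ProbabilityTheory.cdf_eq_real]
  · have : IsProbabilityMeasure ((volume.restrict (Ioo (0 : ℝ) 1)).map Q) :=
      Measure.isProbabilityMeasure_map hmeas.aemeasurable
    refine Measure.ext_of_Iic _ _ fun x => ?_
    rw [Measure.map_apply hmeas measurableSet_Iic, Measure.restrict_apply (hmeas measurableSet_Iic),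
      hpre, ← ProbabilityTheory.ofReal_cdf μ x]
    have h0 := ProbabilityTheory.cdf_nonneg μ x
    have h1 := ProbabilityTheory.cdf_le_one μ x
    refine le_antisymm ?_ ?_
    · calc volume (Iic (F x) ∩ Ioo 0 1) ≤ volume (Ioc 0 (F x)) :=
          measure_mono fun u hu => ⟨hu.2.1, hu.1⟩
        _ = _ := by simp [F]
    · calc ENNReal.ofReal (F x) = volume (Ioo 0 (F x)) := by simp
        _ ≤ volume (Iic (F x) ∩ Ioo 0 1) := measure_mono fun u hu => ⟨hu.2.le, hu.1, hu.2.trans_le h1⟩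

/-- Every atomless standard Borel probability space is parametrized, injectively on a conull set, by
the Lebesgue measure on `(0, 1)`, with a given measurable set corresponding to an initial segment. -/
theorem exists_parametrization {B : Set Ω} (hB : MeasurableSet B) :
    ∃ (h : ℝ → Ω) (S : Set ℝ), Measurable h ∧ MeasurableSet S ∧
      (∀ᵐ u ∂(volume.restrict (Ioo (0 : ℝ) 1)), u ∈ S) ∧ InjOn h S ∧
      (volume.restrict (Ioo (0 : ℝ) 1)).map h = ν ∧ ∀ u ∈ S, h u ∈ B ↔ u ≤ ν.real B := by
  classical
  have : Nonempty Ω := ν.nonempty_of_neZero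
  have hf := measurableEmbedding_embeddingReal Ω
  -- The signed exponential embeds `Ω` in the line with `B` exactly on the negative side, so that
  -- quantiles list `B` first.
  let g : Ω → ℝ := fun x =>
    if x ∈ B then -Real.exp (embeddingReal Ω x) else Real.exp (embeddingReal Ω x)
  have hexp : Measurable fun x => Real.exp (embeddingReal Ω x) :=
    Real.measurable_exp.comp hf.measurable
  have hgm : Measurable g := Measurable.ite hB hexp.neg hexp
  have hgB : ∀ x, g x ≤ 0 ↔ x ∈ B := by
    intro x
    have := Real.exp_pos (embeddingReal Ω x)
    by_cases hx : x ∈ B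
    · simp [g, hx, this.le]
    · simp [g, hx, this]
  have hgi : Function.Injective g := by
    intro x y hxy
    have hiff : x ∈ B ↔ y ∈ B := by rw [← hgB, ← hgB, hxy]
    refine hf.injective (Real.exp_injective ?_)
    by_cases hx : x ∈ B
    · simpa [g, hx, hiff.1 hx] using hxy
    · simpa [g, hx, mt hiff.2 hx] using hxy
  have hg : MeasurableEmbedding g := hgm.measurableEmbedding hgi
  have hprob : IsProbabilityMeasure (ν.map g) := Measure.isProbabilityMeasure_map hgm.aemeasurable
  have hatom : NullSingletonClass (ν.map g) := ⟨fun x => by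
    rw [hg.map_apply]
    exact (subsingleton_singleton.preimage hgi).measure_zero ν⟩
  obtain ⟨Q, hQm, hQi, hQ, hQmap⟩ := exists_quantile (ν.map g)
  refine ⟨hg.invFun ∘ Q, Ioo 0 1 ∩ Q ⁻¹' range g, hg.measurable_invFun.comp hQm,
    measurableSet_Ioo.inter (hQm hg.measurableSet_range), ?_, ?_, ?_, ?_⟩
  · have h1 : ∀ᵐ x ∂(ν.map g), x ∈ range g :=
      (ae_map_iff hgm.aemeasurable hg.measurableSet_range).2 (.of_forall fun x => ⟨x, rfl⟩)
    rw [← hQmap] at h1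
    replace h1 := (ae_map_iff hQm.aemeasurable hg.measurableSet_range).1 h1
    filter_upwards [h1, ae_restrict_mem measurableSet_Ioo] with u hu hu'
    exact ⟨hu', hu⟩
  · rintro u ⟨hu, x, hx⟩ v ⟨hv, y, hy⟩ huv
    refine hQi hu hv ?_
    simp only [Function.comp_apply, ← hx, ← hy, hg.leftInverse_invFun _] at huv
    rw [← hx, ← hy, huv]
  · rw [← Measure.map_map hg.measurable_invFun hQm, hQmap, Measure.map_map hg.measurable_invFun hgm,
      hg.leftInverse_invFun.comp_eq_id, Measure.map_id]
  · rintro u ⟨hu, x, hx⟩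
    rw [Function.comp_apply, ← hx, hg.leftInverse_invFun, ← hgB, hx, hQ u hu 0,
      map_measureReal_apply hgm measurableSet_Iic]
    rw [show g ⁻¹' Iic 0 = B from ext hgB]

/-- In an atomless standard Borel probability space, measurable sets of equal measure are
exchanged, up to a null set, by a measure-preserving automorphism. -/
theorem exists_measurePreserving_measurableEquiv {B B' : Set Ω} (hB : MeasurableSet B)
    (hB' : MeasurableSet B') (heq : ν.real B = ν.real B') :
    ∃ φ : Ω ≃ᵐ Ω, MeasurePreserving φ ν ν ∧ ∀ᵐ x ∂ν, x ∈ B ↔ φ x ∈ B' := by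
  obtain ⟨h, S, hm, hS, hSae, hinj, hmap, hiff⟩ := exists_parametrization ν hB
  obtain ⟨k, T, km, hT, hTae, kinj, kmap, kiff⟩ := exists_parametrization ν hB'
  -- Keeping an uncountable null set out of both images makes their complements uncountable, hence
  -- Borel isomorphic, so that the partial map `h u ↦ k u` extends to a bijection of `Ω`.
  obtain ⟨N, hN, hNc, hN0⟩ := exists_not_countable_null ν
  have hNν : ∀ᵐ x ∂ν, x ∈ Nᶜ := measure_eq_zero_iff_ae_notMem.1 hN0
  have hNh : ∀ᵐ u ∂(volume.restrict (Ioo (0 : ℝ) 1)), h u ∈ Nᶜ := by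
    rw [← hmap] at hNν
    exact (ae_map_iff hm.aemeasurable hN.compl).1 hNν
  have hNk : ∀ᵐ u ∂(volume.restrict (Ioo (0 : ℝ) 1)), k u ∈ Nᶜ := by
    rw [← kmap] at hNν
    exact (ae_map_iff km.aemeasurable hN.compl).1 hNν
  let R : Set ℝ := (S ∩ T) ∩ (h ⁻¹' Nᶜ ∩ k ⁻¹' Nᶜ)
  have hR : MeasurableSet R := (hS.inter hT).inter ((hm hN.compl).inter (km hN.compl))
  have := hR.standardBorel
  have he : MeasurableEmbedding (fun u : R => h u) :=
    (hm.comp measurable_subtype_coe).measurableEmbedding fun u v huv =>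
      Subtype.ext (hinj u.2.1.1 v.2.1.1 huv)
  have ke : MeasurableEmbedding (fun u : R => k u) :=
    (km.comp measurable_subtype_coe).measurableEmbedding fun u v huv =>
      Subtype.ext (kinj u.2.1.2 v.2.1.2 huv)
  have hV := he.measurableSet_range
  have kV := ke.measurableSet_range
  have := hV.compl.standardBorel
  have := kV.compl.standardBorel
  have hc : ¬ Countable ↑(range fun u : R => h u)ᶜ := fun hc => by
    refine hNc ((countable_coe_iff.1 hc).mono ?_)
    rintro _ hx ⟨u, rfl⟩
    exact u.2.2.1 hx
  have kc : ¬ Countable ↑(range fun u : R => k u)ᶜ := fun hc => by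
    refine hNc ((countable_coe_iff.1 hc).mono ?_)
    rintro _ hx ⟨u, rfl⟩
    exact u.2.2.2 hx
  classical
  let φ : Ω ≃ᵐ Ω := (MeasurableEquiv.sumCompl hV).symm.trans
    ((MeasurableEquiv.sumCongr (he.equivRange.symm.trans ke.equivRange)
      (PolishSpace.measurableEquivOfNotCountable hc kc)).trans (MeasurableEquiv.sumCompl kV))
  have hφ : ∀ u ∈ R, φ (h u) = k u := by
    intro u hu
    have h1 : (MeasurableEquiv.sumCompl hV).symm (h u) = Sum.inl ⟨h u, ⟨u, hu⟩, rfl⟩ :=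
      Equiv.Set.sumCompl_symm_apply_of_mem (s := range fun u : R => h u) ⟨⟨u, hu⟩, rfl⟩
    have h2 : he.equivRange.symm ⟨h u, ⟨u, hu⟩, rfl⟩ = ⟨u, hu⟩ :=
      he.equivRange_symm_apply_mk ⟨u, hu⟩
    show MeasurableEquiv.sumCompl kV (Sum.map _ _ ((MeasurableEquiv.sumCompl hV).symm (h u))) = _
    rw [h1, Sum.map_inl]
    show ((ke.equivRange (he.equivRange.symm ⟨h u, ⟨u, hu⟩, rfl⟩) : _) : Ω) = k u
    rw [h2, ke.equivRange_apply]
  have hRae : ∀ᵐ u ∂(volume.restrict (Ioo (0 : ℝ) 1)), u ∈ R := by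
    filter_upwards [hSae, hTae, hNh, hNk] with u h1 h2 h3 h4
    exact ⟨⟨h1, h2⟩, h3, h4⟩
  refine ⟨φ, ⟨φ.measurable, ?_⟩, ?_⟩
  · nth_rw 1 [← hmap]
    rw [Measure.map_map φ.measurable hm, ← kmap]
    refine Measure.map_congr ?_
    filter_upwards [hRae] with u hu
    exact hφ u hu
  · have hset : MeasurableSet {x | x ∈ B ↔ φ x ∈ B'} :=
      hB.iff (φ.measurable hB')
    rw [← hmap]
    refine (ae_map_iff hm.aemeasurable hset).2 ?_
    filter_upwards [hRae] with u hu
    rw [hiff u hu.1.1, hφ u hu, kiff u hu.1.2, heq]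

end MeasureTheory

/-! ### Identification of the extremal graphons -/

namespace Graphon

variable {Ω : Type*} [MeasurableSpace Ω] [StandardBorelSpace Ω] {W : Graphon Ω} {ν : Measure Ω}
  [IsProbabilityMeasure ν] [NullSingletonClass ν]

theorem isomorphic_of_isPsi {P A : Set Ω} {Ψ : Graphon Ω} {e : ℝ}
    (hA : MeasurableSet A) (hAP : A ⊆ P) (hPA : ν.real A = ν.real P)
    (he : ν.real A = 1 - √(1 - e))
    (hW : ∀ᵐ z ∂(ν.prod ν), W z.1 z.2 = (coveredPairs P A).indicator 1 z) (hΨ : Ψ.IsPsi ν e) :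
    W.Isomorphic Ψ ν := by
  obtain ⟨B, hB, hν, h0, h1⟩ := hΨ
  obtain ⟨φ, hφ, hiff⟩ := exists_measurePreserving_measurableEquiv ν hA hB (he.trans hν.symm)
  -- Once `A` and `P` agree almost everywhere, a pair is covered when at least one coordinate lies
  -- in `A`.
  have hae : A =ᵐ[ν] P := ae_eq_of_subset_of_measure_ge hAP
    ((measureReal_eq_measureReal_iff).1 hPA).ge hA.nullMeasurableSet (measure_ne_top _ _)
  refine ⟨φ, hφ, ?_⟩
  filter_upwards [hW, ae_prod_of_ae hiff, ae_prod_of_ae hae.mem_iff] with z hz hzB hzP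
  rw [hz]
  by_cases h : φ z.1 ∉ B ∧ φ z.2 ∉ B
  · rw [h0 _ _ h, indicator_of_notMem]
    simp only [coveredPairs, mem_ofPred_eq, ← hzP.1, ← hzP.2, hzB.1, hzB.2]
    tauto
  · rw [h1 _ _ h, indicator_of_mem, Pi.one_apply]
    simp only [coveredPairs, mem_ofPred_eq, ← hzP.1, ← hzP.2, hzB.1, hzB.2]
    tauto

theorem isomorphic_of_isPhi {P A : Set Ω} {Φ : Graphon Ω} {e : ℝ} (hP : MeasurableSet P)
    (hA0 : ν.real A = 0) (he : ν.real P = √e)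
    (hW : ∀ᵐ z ∂(ν.prod ν), W z.1 z.2 = (coveredPairs P A).indicator 1 z) (hΦ : Φ.IsPhi ν e) :
    W.Isomorphic Φ ν := by
  obtain ⟨C, hC, hν, h1, h0⟩ := hΦ
  obtain ⟨φ, hφ, hiff⟩ := exists_measurePreserving_measurableEquiv ν hP hC (he.trans hν.symm)
  have hae : ∀ᵐ x ∂ν, x ∉ A := measure_eq_zero_iff_ae_notMem.1 ((measureReal_eq_zero_iff).1 hA0)
  refine ⟨φ, hφ, ?_⟩
  filter_upwards [hW, ae_prod_of_ae hiff, ae_prod_of_ae hae] with z hz hzC hzA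
  rw [hz]
  by_cases h : φ z.1 ∈ C ∧ φ z.2 ∈ C
  · rw [h1 _ _ h, indicator_of_mem, Pi.one_apply]
    simp only [coveredPairs, mem_ofPred_eq, hzC.1, hzC.2]
    tauto
  · rw [h0 _ _ h, indicator_of_notMem]
    simp only [coveredPairs, mem_ofPred_eq, hzC.1, hzC.2]
    tauto

end Graphon

end

theorem mainTheorem5 {Ω : Type*} [MeasurableSpace Ω] [StandardBorelSpace Ω]
    (ν : Measure Ω) [IsProbabilityMeasure ν] [NullSingletonClass ν]
    (W : Graphon Ω) (e : ℝ) (he : e = W.edgeDensity ν) :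
    -- the lower bound
    min √(e / 4) (1 - √(1 - e)) ≤ W.fracCoverRatio ν ∧
    -- the transition at edge density 0.64
    (e ≤ 0.64 → min √(e / 4) (1 - √(1 - e)) = 1 - √(1 - e)) ∧
    (0.64 ≤ e → min √(e / 4) (1 - √(1 - e)) = √(e / 4)) ∧
    -- the extremal graphons
    (∃ Ψ : Graphon Ω, Ψ.IsPsi ν e) ∧ (∃ Φ : Graphon Ω, Φ.IsPhi ν e) ∧
    ∀ Ψ Φ : Graphon Ω, Ψ.IsPsi ν e → Φ.IsPhi ν e →
      (W.fracCoverRatio ν = min √(e / 4) (1 - √(1 - e)) ↔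
        (e ≤ 0.64 ∧ W.Isomorphic Ψ ν) ∨ (0.64 ≤ e ∧ W.Isomorphic Φ ν)) := by
  subst he
  obtain ⟨he0, he1⟩ := W.edgeDensity_mem_Icc (ν := ν)
  refine ⟨W.min_le_fracCoverRatio, min_sqrt_eq_right he0 he1, min_sqrt_eq_left he1,
    Graphon.exists_isPsi ν ⟨he0, he1⟩, Graphon.exists_isPhi ν ⟨he0, he1⟩, fun Ψ Φ hΨ hΦ => ?_⟩
  constructor
  · intro hmin
    obtain ⟨P, A, h, hAP, heq⟩ := Graphon.exists_isSetCover_eq (W := W) (ν := ν)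
    obtain ⟨hd, hcase⟩ := eq_or_eq_zero_of_eq_min (t := W.fracCoverRatio ν) (by linarith)
      measureReal_nonneg (measureReal_mono hAP) measureReal_le_one (h.edgeDensity_le hAP) he0 he1
      hmin
    have hW := h.ae_eq_indicator hAP hd
    rcases hcase with ⟨hAP', hA⟩ | ⟨hpos, hA, hP⟩
    · refine .inl ⟨?_, Graphon.isomorphic_of_isPsi h.right hAP hAP' hA hW hΨ⟩
      -- The threshold criterion needs `e > 0`; at `e = 0` the bound is immediate.
      rcases he0.eq_or_lt with h0 | h0
      · rw [← h0]; norm_num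
      · refine (sqrt_one_sub_le_iff h0 he1).1 ?_
        rw [← hA, show ν.real A = W.fracCoverRatio ν by linarith, hmin]
        exact min_le_left _ _
    · refine .inr ⟨?_, Graphon.isomorphic_of_isPhi h.left hA hP hW hΦ⟩
      refine (sqrt_le_one_sub_iff hpos he1).1 ?_
      rw [Real.sqrt_div he0, ← hP, show (4 : ℝ) = 2 ^ 2 by norm_num, Real.sqrt_sq zero_le_two,
        show ν.real P / 2 = W.fracCoverRatio ν by linarith, hmin]
      exact min_le_right _ _
  · rintro (⟨hle, hiso⟩ | ⟨hle, hiso⟩)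
    · refine le_antisymm ?_ W.min_le_fracCoverRatio
      rw [min_sqrt_eq_right he0 he1 hle]
      exact hiso.fracCoverRatio_le_of_isPsi hΨ
    · refine le_antisymm ?_ W.min_le_fracCoverRatio
      rw [min_sqrt_eq_left he1 hle]
      exact hiso.fracCoverRatio_le_of_isPhi hΦ
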